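/- Let $K\subset\mathbb{R}^3$ be a compact convex set of constant width $a>0$, that is, for every unit vector $u$ the two support planes of $K$ orthogonal to $u$ are at distance $a$. Let $r$ be its inradius (the largest radius of a ball contained in $K$), $R$ its circumradius (the smallest radius of a ball containing $K$), and $c=r/R$. For an affine plane $E$ let $L(K\cap E)$ be the length of the boundary, relative to $E$, of the section $K\cap E$ (zero if $K\cap E=\emptyset$), and let $dE$ be the rigid-motion invariant measure on affine planes given by $dE=\tfrac12\,du\,dt$ for $E=\{x:\langle u,x\rangle=t\}$, where $(u,t)\in S^2\times\mathbb{R}$ (each plane being represented twice) and $du$ is the surface measure on $S^2$. Then $$\int L(K\cap E)^2\,dE\;\le\;8\pi^3a^3\left(\frac1{(1+c)^2}-\frac1{12}\right),$$ and equality holds if $K$ is a ball. Moreover, $$\int L(K\cap E)^2\,dE\;\le\;\frac73\,\pi^3a^3 .$$ -/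

import Mathlib

open MeasureTheory

noncomputable section

/-- Euclidean three-dimensional space. -/
abbrev E3 : Type := EuclideanSpace ℝ (Fin 3)

/-- The unit sphere of directions in Euclidean three-space. -/
abbrev S2 : Type := Metric.sphere (0 : E3) 1

/-! ### Convex bodies of constant width -/

/-- The support function `h_K(u) = sup {⟪u, x⟫ : x ∈ K}`. -/
def supportFun (K : ConvexBody E3) (u : E3) : ℝ :=
  sSup ((fun x : E3 => inner ℝ u x) '' (K : Set E3))

/-- The width of `K` in direction `u`, that is the distance between the two support planes
of `K` orthogonal to the unit vector `u`. -/
def width (K : ConvexBody E3) (u : S2) : ℝ :=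
  supportFun K (u : E3) + supportFun K (-(u : E3))

/-- `K` has constant width `a`. -/
def HasConstantWidth (K : ConvexBody E3) (a : ℝ) : Prop :=
  ∀ u : S2, width K u = a

/-- The inradius: the supremum of the radii of the balls contained in `K`. -/
def inradius (K : ConvexBody E3) : ℝ :=
  sSup {ρ : ℝ | 0 ≤ ρ ∧ ∃ x : E3, Metric.closedBall x ρ ⊆ (K : Set E3)}

/-- The circumradius: the infimum of the radii of the balls containing `K`. -/
def circumradius (K : ConvexBody E3) : ℝ :=
  sInf {ρ : ℝ | 0 ≤ ρ ∧ ∃ x : E3, (K : Set E3) ⊆ Metric.closedBall x ρ}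

/-! ### Affine planes and their invariant measure -/

/-- The set of affine planes in Euclidean three-space. -/
def AffinePlane : Type :=
  {E : AffineSubspace ℝ E3 // Module.finrank ℝ E.direction = 2}

/-- The plane with unit normal `u` at signed distance `t` from the origin, that is the plane
`{x | ⟪u, x⟫ = t}`.  Every plane is obtained from exactly two pairs, `(u, t)` and `(-u, -t)`. -/
def planeOf (q : S2 × ℝ) : AffinePlane :=
  ⟨AffineSubspace.mk' (q.2 • (q.1 : E3)) (Submodule.span ℝ {(q.1 : E3)})ᗮ, by
    have : Fact (Module.finrank ℝ E3 = 2 + 1) := ⟨by simp⟩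
    rw [AffineSubspace.direction_mk']
    exact Submodule.finrank_orthogonal_span_singleton (ne_zero_of_mem_unit_sphere q.1)⟩

/-- The Borel structure of the space of planes, as the quotient of `S2 × ℝ` by
`(u, t) ∼ (-u, -t)`. -/
instance : MeasurableSpace AffinePlane :=
  MeasurableSpace.map planeOf inferInstance

/-- The measure `dE = ½ du dt` on affine planes, invariant under rigid motions; here `du` is
the surface measure of the unit sphere (of total mass `4π`), and the factor `½` compensates
for the double parametrization. -/
def planeMeasure : Measure AffinePlane :=
  Measure.map planeOf
    ((2 : ENNReal)⁻¹ • ((volume : Measure E3).toSphere.prod (volume : Measure ℝ)))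

/-- The boundary of the section `K ∩ E`, taken relative to the plane `E`. -/
def sectionBoundary (K : ConvexBody E3) (E : AffinePlane) : Set E3 :=
  ((↑) : E.1 → E3) '' frontier (((↑) : E.1 → E3) ⁻¹' (K : Set E3))

/-- `L(K ∩ E)`: the length (one-dimensional Hausdorff measure) of the boundary curve of the
section `K ∩ E`; it is `0` when `K` and `E` are disjoint. -/
def sectionLength (K : ConvexBody E3) (E : AffinePlane) : ENNReal :=
  Measure.hausdorffMeasure 1 (sectionBoundary K E)

end

/-! Let `K` lie in a ball of radius `ρ` about `x₀`. Nearest-point projection onto a convex planar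
section does not increase length, so the perimeter of each section of `K` is at most that of the
disc cut from the ball (`sectionLength_le`). With `τ` the signed distance from `x₀` to the plane,
the squared perimeter is thus at most `4π²(ρ² - τ²)`.

In each direction the planes meeting `K` fill an interval of length `a`. The second moment of such
an interval about any point is at least `a³/12`, so integrating over `t` and then over the sphere
gives `8π³(aρ² - a³/12)` (`HasConstantWidth.lintegral_le_of_subset_closedBall`). Letting `ρ`
decrease to `R` leaves a bound in `R` alone.

Two estimates of `R` finish the proof: `r + R ≤ a` gives `R/a ≤ 1/(1+c)`, and Jung's theorem gives
`R² ≤ 3a²/8`, whence the constant `8(3/8 - 1/12) = 7/3`. For a ball the sections are discs centred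
at the foot of `x₀`, and every inequality is an equality. -/

noncomputable section


/-! ### Jung's theorem -/

section Jung

variable {F : Type*} [NormedAddCommGroup F] [InnerProductSpace ℝ F]

/-- The variance of a family of points with weights `w`. -/
def weightedVariance {ι : Type*} [Fintype ι] (x : ι → F) (w : ι → ℝ) : ℝ :=
  ∑ i, w i * ‖x i‖ ^ 2 - ‖∑ i, w i • x i‖ ^ 2

theorem two_mul_weightedVariance {ι : Type*} [Fintype ι] (x : ι → F) {w : ι → ℝ}
    (hw : ∑ i, w i = 1) :
    2 * weightedVariance x w = ∑ i, ∑ j, w i * w j * ‖x i - x j‖ ^ 2 := by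
  have h : ∀ i j, w i * w j * ‖x i - x j‖ ^ 2
      = (w i * ‖x i‖ ^ 2) * w j + w i * (w j * ‖x j‖ ^ 2)
        - 2 * inner ℝ (w i • x i) (w j • x j) := by
    intro i j
    rw [norm_sub_sq_real, inner_smul_left, inner_smul_right]
    simp only [conj_trivial]
    ring
  simp_rw [h, Finset.sum_sub_distrib, Finset.sum_add_distrib, ← Finset.mul_sum, ← Finset.sum_mul,
    ← inner_sum]
  rw [← sum_inner, hw, real_inner_self_eq_norm_sq, weightedVariance]
  ring

/-- In the double sum over pairs the diagonal terms vanish, which leaves at most `d²(1 - ∑ wᵢ²)`;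
Cauchy-Schwarz gives `∑ wᵢ² ≥ 1/n`. -/
theorem weightedVariance_le {ι : Type*} [Fintype ι] [Nonempty ι] (x : ι → F) {w : ι → ℝ}
    (hw : w ∈ stdSimplex ℝ ι) {d : ℝ} (hd : ∀ i j, ‖x i - x j‖ ≤ d) :
    weightedVariance x w ≤ d ^ 2 / 2 * (1 - 1 / Fintype.card ι) := by
  classical
  have hterm : ∀ i j, w i * w j * ‖x i - x j‖ ^ 2
      ≤ w i * w j * d ^ 2 - (if i = j then w i ^ 2 * d ^ 2 else 0) := by
    intro i j
    split_ifs with h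
    · subst h; simp; nlinarith
    · have := pow_le_pow_left₀ (norm_nonneg _) (hd i j) 2
      have := mul_le_mul_of_nonneg_left this (mul_nonneg (hw.1 i) (hw.1 j))
      linarith
  have hsum := Finset.sum_le_sum fun i (_ : i ∈ Finset.univ) =>
    Finset.sum_le_sum fun j (_ : j ∈ Finset.univ) => hterm i j
  rw [← two_mul_weightedVariance x hw.2] at hsum
  have hcs : (1 : ℝ) ≤ Fintype.card ι * ∑ i, w i ^ 2 := by
    have := sq_sum_le_card_mul_sum_sq (s := Finset.univ) (f := w)
    rwa [hw.2, one_pow, Finset.card_univ] at this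
  have hcard : (0 : ℝ) < Fintype.card ι := by exact_mod_cast Fintype.card_pos
  have hinv : 1 / (Fintype.card ι : ℝ) ≤ ∑ i, w i ^ 2 := by
    rw [div_le_iff₀ hcard]; linarith
  have hrhs : ∑ i, ∑ j, (w i * w j * d ^ 2 - (if i = j then w i ^ 2 * d ^ 2 else 0))
      = d ^ 2 - (∑ i, w i ^ 2) * d ^ 2 := by
    simp_rw [Finset.sum_sub_distrib, Finset.sum_ite_eq, Finset.mem_univ, if_true,
      ← Finset.sum_mul, ← Finset.mul_sum, hw.2, mul_one]
    rw [hw.2, one_mul]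
  rw [hrhs] at hsum
  nlinarith [sq_nonneg d]

/-- Shifting a fraction `s` of the mass to the point `x j`: the first-order change in `s` compares
the squared distance from `x j` to the barycentre with the variance. -/
theorem weightedVariance_move {ι : Type*} [Fintype ι] [DecidableEq ι] (x : ι → F) (w : ι → ℝ)
    (j : ι) (s : ℝ) :
    weightedVariance x ((1 - s) • w + s • Pi.single j 1)
      = (1 - s) * weightedVariance x w + s * (1 - s) * ‖x j - ∑ i, w i • x i‖ ^ 2 := by
  have h1 : ∑ i, ((1 - s) • w + s • Pi.single j 1 : ι → ℝ) i * ‖x i‖ ^ 2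
      = (1 - s) * ∑ i, w i * ‖x i‖ ^ 2 + s * ‖x j‖ ^ 2 := by
    simp [add_mul, Finset.sum_add_distrib, Finset.mul_sum, mul_assoc, Pi.single_apply]
  have h2 : ∑ i, ((1 - s) • w + s • Pi.single j 1 : ι → ℝ) i • x i
      = (1 - s) • ∑ i, w i • x i + s • x j := by
    simp [add_smul, Finset.sum_add_distrib, Finset.smul_sum, mul_smul, Pi.single_apply]
  rw [weightedVariance, h1, h2, weightedVariance, norm_add_sq_real, norm_sub_sq_real, norm_smul,
    norm_smul, mul_pow, mul_pow, inner_smul_left, inner_smul_right, Real.norm_eq_abs,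
    Real.norm_eq_abs, sq_abs, sq_abs, real_inner_comm]
  simp only [conj_trivial]
  ring

/-- Jung's theorem for a finite family of points. -/
theorem exists_norm_sub_sq_le_of_finite {ι : Type*} [Fintype ι] [Nonempty ι] (x : ι → F) {d : ℝ}
    (hd : ∀ i j, ‖x i - x j‖ ≤ d) :
    ∃ z : F, ∀ j, ‖x j - z‖ ^ 2 ≤ d ^ 2 / 2 * (1 - 1 / Fintype.card ι) := by
  classical
  have hcont : Continuous (weightedVariance x) := by unfold weightedVariance; fun_prop
  -- The centre is the barycentre for weights of maximal variance. Shifting mass to any `x j` cannot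
  -- increase the variance, which forces the squared distance from `x j` to be at most the variance.
  obtain ⟨w, hw, hmax⟩ := (isCompact_stdSimplex ℝ ι).exists_isMaxOn
    ⟨_, single_mem_stdSimplex ℝ (Classical.arbitrary ι)⟩ hcont.continuousOn
  refine ⟨∑ i, w i • x i, fun j => le_trans ?_ (weightedVariance_le x hw hd)⟩
  set D := ‖x j - ∑ i, w i • x i‖ ^ 2 with hD
  have key : ∀ s ∈ Set.Ioo (0 : ℝ) 1, (1 - s) * D ≤ weightedVariance x w := by
    intro s hs
    have hmem : (1 - s) • w + s • Pi.single j 1 ∈ stdSimplex ℝ ι :=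
      convex_stdSimplex ℝ ι hw (single_mem_stdSimplex ℝ j) (by linarith [hs.2]) hs.1.le (by ring)
    have h := hmax hmem
    simp only [Set.mem_ofPred_eq] at h
    rw [weightedVariance_move, ← hD] at h
    have : s * ((1 - s) * D) ≤ s * weightedVariance x w := by linarith
    exact le_of_mul_le_mul_left this hs.1
  have hlim : Filter.Tendsto (fun s : ℝ => (1 - s) * D) (nhdsWithin 0 (Set.Ioi 0)) (nhds D) := by
    have : Continuous fun s : ℝ => (1 - s) * D := by fun_prop
    simpa using (this.tendsto 0).mono_left nhdsWithin_le_nhds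
  refine le_of_tendsto hlim ?_
  filter_upwards [Ioo_mem_nhdsGT (zero_lt_one' ℝ)] with s hs using key s hs

/-- Jung's theorem. -/
theorem exists_subset_closedBall_of_diam_le [FiniteDimensional ℝ F] {S : Set F} {d : ℝ}
    (hd : ∀ x ∈ S, ∀ y ∈ S, ‖x - y‖ ≤ d) :
    ∃ z : F, S ⊆ Metric.closedBall z
      (√(d ^ 2 / 2 * (1 - 1 / (Module.finrank ℝ F + 1)))) := by
  set ρ := √(d ^ 2 / 2 * (1 - 1 / (Module.finrank ℝ F + 1))) with hρ
  have : (⋂ x : S, Metric.closedBall (x : F) ρ).Nonempty := by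
    -- By Helly, it suffices to treat at most `finrank + 1` points; the finite bound increases with
    -- the number of points.
    refine Convex.helly_theorem_compact' (𝕜 := ℝ) (fun x => convex_closedBall _ _)
      (fun x => isCompact_closedBall _ _) fun I hI => ?_
    rcases I.eq_empty_or_nonempty with rfl | hne
    · simp
    have : Nonempty I := hne.to_subtype
    obtain ⟨z, hz⟩ := exists_norm_sub_sq_le_of_finite (fun i : I => ((i : S) : F)) (d := d)
      fun i j => hd _ i.1.2 _ j.1.2
    refine ⟨z, Set.mem_iInter₂.2 fun x hx => ?_⟩
    rw [Metric.mem_closedBall, dist_comm, dist_eq_norm]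
    refine Real.le_sqrt_of_sq_le ((hz ⟨x, hx⟩).trans ?_)
    have hpos : (0 : ℝ) < Fintype.card I := by exact_mod_cast Fintype.card_pos
    have hle : (Fintype.card I : ℝ) ≤ Module.finrank ℝ F + 1 := by
      rw [Fintype.card_coe]; exact_mod_cast hI
    have := one_div_le_one_div_of_le hpos hle
    gcongr
  obtain ⟨z, hz⟩ := this
  refine ⟨z, fun x hx => ?_⟩
  have := Set.mem_iInter.1 hz ⟨x, hx⟩
  rw [Metric.mem_closedBall, dist_comm]
  exact Metric.mem_closedBall.1 this

end Jung


/-! ### The length of a circle -/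

section Circle

variable {F : Type*} [NormedAddCommGroup F] [InnerProductSpace ℝ F]

/-- The circle with centre `m` and radius `s` in the plane spanned by `e₁` and `e₂`. -/
def circleCurve (m e₁ e₂ : F) (s θ : ℝ) : F :=
  m + (s * Real.cos θ) • e₁ + (s * Real.sin θ) • e₂

variable {m e₁ e₂ : F} {s : ℝ}

theorem norm_smul_add_smul_sq (h₁ : ‖e₁‖ = 1) (h₂ : ‖e₂‖ = 1) (h₁₂ : inner ℝ e₁ e₂ = 0)
    (p q : ℝ) : ‖p • e₁ + q • e₂‖ ^ 2 = p ^ 2 + q ^ 2 := by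
  rw [norm_add_sq_real, norm_smul, norm_smul, inner_smul_left, inner_smul_right, h₁, h₂, h₁₂]
  simp

theorem norm_circleCurve_sub_sq (h₁ : ‖e₁‖ = 1) (h₂ : ‖e₂‖ = 1) (h₁₂ : inner ℝ e₁ e₂ = 0)
    (α β : ℝ) : ‖circleCurve m e₁ e₂ s α - circleCurve m e₁ e₂ s β‖ ^ 2
      = s ^ 2 * (2 - 2 * Real.cos (α - β)) := by
  have : circleCurve m e₁ e₂ s α - circleCurve m e₁ e₂ s β
      = (s * Real.cos α - s * Real.cos β) • e₁ + (s * Real.sin α - s * Real.sin β) • e₂ := by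
    simp only [circleCurve, sub_smul]; abel
  rw [this, norm_smul_add_smul_sq h₁ h₂ h₁₂, Real.cos_sub]
  linear_combination s ^ 2 * Real.cos_sq_add_sin_sq α + s ^ 2 * Real.cos_sq_add_sin_sq β

theorem continuous_circleCurve : Continuous (circleCurve m e₁ e₂ s) := by
  unfold circleCurve; fun_prop

theorem lipschitzWith_circleCurve (hs : 0 ≤ s) (h₁ : ‖e₁‖ = 1) (h₂ : ‖e₂‖ = 1)
    (h₁₂ : inner ℝ e₁ e₂ = 0) : LipschitzWith s.toNNReal (circleCurve m e₁ e₂ s) := by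
  refine LipschitzWith.of_dist_le_mul fun α β => ?_
  rw [Real.coe_toNNReal _ hs, dist_eq_norm, Real.dist_eq]
  refine abs_le_of_sq_le_sq' ?_ (by positivity) |>.2
  rw [norm_circleCurve_sub_sq h₁ h₂ h₁₂, mul_pow, sq_abs]
  have := Real.one_sub_sq_div_two_le_cos (x := α - β)
  gcongr
  linarith

theorem injOn_circleCurve (hs : 0 < s) (h₁ : ‖e₁‖ = 1) (h₂ : ‖e₂‖ = 1)
    (h₁₂ : inner ℝ e₁ e₂ = 0) :
    Set.InjOn (circleCurve m e₁ e₂ s) (Set.Ico (-Real.pi) Real.pi) := by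
  intro α hα β hβ h
  have h0 := norm_circleCurve_sub_sq (m := m) (s := s) h₁ h₂ h₁₂ α β
  rw [h, sub_self, norm_zero] at h0
  have hcos : Real.cos (α - β) = 1 := by
    have : s ^ 2 ≠ 0 := by positivity
    have h3 : s ^ 2 * (2 - 2 * Real.cos (α - β)) = 0 := by linarith
    have := (mul_eq_zero.1 h3).resolve_left this
    linarith
  rw [Real.cos_eq_one_iff_of_lt_of_lt (by linarith [hα.1, hβ.2]) (by linarith [hα.2, hβ.1])]
    at hcos
  linarith

variable [MeasurableSpace F] [BorelSpace F]

theorem hausdorffMeasure_circleCurve_le (hs : 0 ≤ s) (h₁ : ‖e₁‖ = 1) (h₂ : ‖e₂‖ = 1)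
    (h₁₂ : inner ℝ e₁ e₂ = 0) :
    Measure.hausdorffMeasure 1 (circleCurve m e₁ e₂ s '' Set.Icc (-Real.pi) Real.pi)
      ≤ ENNReal.ofReal (2 * Real.pi * s) := by
  refine (((lipschitzWith_circleCurve (m := m) hs h₁ h₂ h₁₂).lipschitzOnWith
    ).hausdorffMeasure_image_le zero_le_one).trans ?_
  rw [hausdorffMeasure_real, Real.volume_Icc, ENNReal.rpow_one, ← ENNReal.ofReal.eq_1,
    ← ENNReal.ofReal_mul hs]
  exact ENNReal.ofReal_le_ofReal (by linarith)

/-- A circular arc is at least as long as its chord. -/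
theorem le_hausdorffMeasure_arc (h₁ : ‖e₁‖ = 1) (h₂ : ‖e₂‖ = 1)
    (h₁₂ : inner ℝ e₁ e₂ = 0) (α : ℝ) {δ : ℝ} (hδ : 0 ≤ δ) :
    ENNReal.ofReal (2 * s * Real.sin δ) ≤ Measure.hausdorffMeasure 1
      (circleCurve m e₁ e₂ s '' Set.Ico (α - δ) (α + δ)) := by
  -- The unit tangent at the midpoint of the arc. Projection to it is 1-Lipschitz and sends the arc
  -- onto a set containing an interval as long as the chord.
  set τ : F := (-Real.sin α) • e₁ + Real.cos α • e₂ with hτ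
  have hτn : ‖τ‖ = 1 := by
    have := norm_smul_add_smul_sq h₁ h₂ h₁₂ (-Real.sin α) (Real.cos α)
    rw [neg_sq, Real.sin_sq_add_cos_sq, ← hτ] at this
    nlinarith [norm_nonneg τ]
  let f : F → ℝ := fun x => inner ℝ τ (x - m)
  have hf : LipschitzWith 1 f := by
    refine LipschitzWith.of_dist_le_mul fun x y => ?_
    rw [Real.dist_eq, dist_eq_norm]
    simp only [f]
    rw [← inner_sub_right, sub_sub_sub_cancel_right]
    simpa [hτn] using abs_real_inner_le_norm τ (x - y)
  have hfγ : ∀ θ, f (circleCurve m e₁ e₂ s θ) = s * Real.sin (θ - α) := by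
    intro θ
    have h₂₁ : inner ℝ e₂ e₁ = 0 := by rw [real_inner_comm]; exact h₁₂
    simp only [f, hτ, circleCurve, add_assoc, add_sub_cancel_left, inner_add_left,
      inner_add_right, inner_smul_left, inner_smul_right, real_inner_self_eq_norm_sq, h₁, h₂, h₁₂,
      h₂₁, conj_trivial, Real.sin_sub]
    ring
  have hsub : Set.Ico (-(s * Real.sin δ)) (s * Real.sin δ)
      ⊆ f '' (circleCurve m e₁ e₂ s '' Set.Ico (α - δ) (α + δ)) := by
    rw [Set.image_image]
    have hc : Continuous fun θ => f (circleCurve m e₁ e₂ s θ) :=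
      hf.continuous.comp continuous_circleCurve
    have := intermediate_value_Ico (show α - δ ≤ α + δ by linarith) hc.continuousOn
    rw [hfγ, hfγ] at this
    simpa using this
  have h := (hf.lipschitzOnWith (s := circleCurve m e₁ e₂ s '' Set.Ico (α - δ) (α + δ))
    ).hausdorffMeasure_image_le zero_le_one
  rw [ENNReal.coe_one, ENNReal.one_rpow, one_mul] at h
  refine le_trans ?_ h
  refine le_trans ?_ (measure_mono hsub)
  rw [hausdorffMeasure_real, Real.volume_Ico]
  exact ENNReal.ofReal_le_ofReal (by linarith)

/-- Inscribed regular polygons: `n` disjoint arcs of half-angle `π/n` are each at least as long as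
their chords, and the perimeters tend to `2πs`. Half-open arcs make the union disjoint. -/
theorem le_hausdorffMeasure_circleCurve (hs : 0 < s) (h₁ : ‖e₁‖ = 1) (h₂ : ‖e₂‖ = 1)
    (h₁₂ : inner ℝ e₁ e₂ = 0) :
    ENNReal.ofReal (2 * Real.pi * s) ≤ Measure.hausdorffMeasure 1
      (circleCurve m e₁ e₂ s '' Set.Ico (-Real.pi) Real.pi) := by
  have hπ := Real.pi_pos
  have hpoly : ∀ n : ℕ, 1 ≤ n → ENNReal.ofReal (n * (2 * s * Real.sin (Real.pi / n)))
      ≤ Measure.hausdorffMeasure 1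
        (circleCurve m e₁ e₂ s '' Set.Ico (-Real.pi) Real.pi) := by
    intro n hn
    have hn0 : (0 : ℝ) < n := by exact_mod_cast hn
    set δ := Real.pi / n with hδ
    have hδ0 : 0 < δ := by positivity
    have hnδ : n * δ = Real.pi := by rw [hδ]; field_simp
    let g : ℕ → ℝ := fun k => -Real.pi + 2 * δ * k
    have hg : Monotone g := fun k l hkl => by
      have : (k : ℝ) ≤ l := by exact_mod_cast hkl
      simp only [g]; gcongr
    have hsub : ∀ k ∈ Finset.range n,
        Set.Ico (g k) (g (k + 1)) ⊆ Set.Ico (-Real.pi) Real.pi := by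
      intro k hk
      have hk' : ((k + 1 : ℕ) : ℝ) ≤ n := by exact_mod_cast Finset.mem_range.1 hk
      refine Set.Ico_subset_Ico ?_ ?_
      · simp only [g]; linarith [show 0 ≤ 2 * δ * k by positivity]
      · simp only [g]; nlinarith
    have hinj := injOn_circleCurve (m := m) hs h₁ h₂ h₁₂
    have hmeas : ∀ k ∈ Finset.range n,
        MeasurableSet (circleCurve m e₁ e₂ s '' Set.Ico (g k) (g (k + 1))) := fun k hk =>
      measurableSet_Ico.image_of_continuousOn_injOn continuous_circleCurve.continuousOn
        (hinj.mono (hsub k hk))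
    have hdisj : (Finset.range n : Set ℕ).PairwiseDisjoint
        fun k => circleCurve m e₁ e₂ s '' Set.Ico (g k) (g (k + 1)) := by
      intro k hk l hl hkl
      have := hg.pairwise_disjoint_on_Ico_succ hkl
      simp only [Function.onFun, Order.succ_eq_add_one] at this ⊢
      rw [Set.disjoint_left] at this ⊢
      rintro _ ⟨α, hα, rfl⟩ ⟨β, hβ, hβα⟩
      exact this hα (hinj (hsub l hl hβ) (hsub k hk hα) hβα ▸ hβ)
    calc ENNReal.ofReal (n * (2 * s * Real.sin δ))
        = ∑ _k ∈ Finset.range n, ENNReal.ofReal (2 * s * Real.sin δ) := by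
          rw [ENNReal.ofReal_mul hn0.le, ENNReal.ofReal_natCast]; simp
      _ ≤ ∑ k ∈ Finset.range n, Measure.hausdorffMeasure 1
            (circleCurve m e₁ e₂ s '' Set.Ico (g k) (g (k + 1))) := by
          refine Finset.sum_le_sum fun k _ => ?_
          convert! le_hausdorffMeasure_arc (m := m) h₁ h₂ h₁₂ (g k + δ) hδ0.le using 4
          · ring
          · simp only [g]; push_cast; ring
      _ = Measure.hausdorffMeasure 1
            (⋃ k ∈ Finset.range n, circleCurve m e₁ e₂ s '' Set.Ico (g k) (g (k + 1))) :=
          (measure_biUnion_finset hdisj hmeas).symm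
      _ ≤ _ := measure_mono (Set.iUnion₂_subset fun k hk => Set.image_mono (hsub k hk))
  have hlim : Filter.Tendsto
      (fun n : ℕ => ENNReal.ofReal (n * (2 * s * Real.sin (Real.pi / n)))) Filter.atTop
      (nhds (ENNReal.ofReal (2 * Real.pi * s))) := by
    refine ENNReal.tendsto_ofReal ?_
    have h := (Real.hasDerivAt_sin 0).tendsto_slope
    have h2 : Filter.Tendsto (fun n : ℕ => Real.pi / (n : ℝ)) Filter.atTop
        (nhdsWithin 0 {0}ᶜ) := by
      refine tendsto_nhdsWithin_iff.2 ⟨tendsto_const_div_atTop_nhds_zero_nat _, ?_⟩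
      filter_upwards [Filter.eventually_gt_atTop 0] with n hn
      have : (0 : ℝ) < n := by exact_mod_cast hn
      exact (div_pos hπ this).ne'
    have h3 := (h.comp h2).const_mul (2 * Real.pi * s)
    rw [Real.cos_zero, mul_one] at h3
    refine h3.congr' ?_
    filter_upwards [Filter.eventually_gt_atTop 0] with n hn
    have : (0 : ℝ) < n := by exact_mod_cast hn
    simp only [Function.comp, slope_def_field, Real.sin_zero, sub_zero]
    field_simp
  refine le_of_tendsto hlim ?_
  filter_upwards [Filter.eventually_ge_atTop 1] with n hn using hpoly n hn

end Circle


/-! ### Monotonicity of the perimeter of plane sections -/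

section Projection

variable {F : Type*} [NormedAddCommGroup F] [InnerProductSpace ℝ F]

/-- The nearest-point map; it is 1-Lipschitz by adding the variational inequalities at two points.
The last clause identifies a value of `P` from that inequality alone. -/
theorem exists_convexProjection {S : Set F} (hne : S.Nonempty) (hS : IsComplete S)
    (hconv : Convex ℝ S) :
    ∃ P : F → F, LipschitzWith 1 P ∧ (∀ y, P y ∈ S) ∧
      (∀ y, ∀ w ∈ S, inner ℝ (y - P y) (w - P y) ≤ 0) ∧
      ∀ y, ∀ q ∈ S, (∀ w ∈ S, inner ℝ (y - q) (w - q) ≤ 0) → P y = q := by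
  have hex : ∀ y, ∃ q ∈ S, ∀ w ∈ S, inner ℝ (y - q) (w - q) ≤ 0 := by
    intro y
    obtain ⟨q, hq, h⟩ := exists_norm_eq_iInf_of_complete_convex hne hS hconv y
    exact ⟨q, hq, (norm_eq_iInf_iff_real_inner_le_zero hconv hq).1 h⟩
  have hcontr : ∀ x y p q : F, p ∈ S → q ∈ S → (∀ w ∈ S, inner ℝ (x - p) (w - p) ≤ 0) →
      (∀ w ∈ S, inner ℝ (y - q) (w - q) ≤ 0) → ‖p - q‖ ≤ ‖x - y‖ := by
    intro x y p q hp hq hxp hyq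
    have h1 := hxp q hq
    have h2 := hyq p hp
    have h3 : ‖p - q‖ ^ 2 = inner ℝ (x - y) (p - q) + inner ℝ (x - p) (q - p)
        + inner ℝ (y - q) (p - q) := by
      rw [← neg_sub p q, inner_neg_right, ← real_inner_self_eq_norm_sq, ← inner_neg_left,
        ← inner_add_left, ← inner_add_left]
      congr 1
      abel
    have h4 := real_inner_le_norm (x - y) (p - q)
    by_contra! hlt
    nlinarith [norm_nonneg (x - y)]
  choose P hPS hP using hex
  refine ⟨P, LipschitzWith.of_dist_le_mul fun x y => ?_, hPS, hP, fun y q hq h => ?_⟩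
  · simpa [dist_eq_norm] using hcontr x y _ _ (hPS x) (hPS y) (hP x) (hP y)
  · have := hcontr y y _ _ (hPS y) hq (hP y) h
    simpa [sub_eq_zero] using this

/-- A segment starting at a point of a closed ball can be prolonged to the sphere. -/
theorem exists_norm_lineMap_sub_eq {x₀ q y : F} {ρ : ℝ} (hqy : y ≠ q)
    (hy : ‖y - x₀‖ ≤ ρ) : ∃ r : ℝ, 1 ≤ r ∧ ‖AffineMap.lineMap q y r - x₀‖ = ρ := by
  have hpos : 0 < ‖y - q‖ := norm_pos_iff.2 (sub_ne_zero.2 hqy)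
  set r₀ := (ρ + ‖q - x₀‖) / ‖y - q‖ with hr₀
  have h1 : 1 ≤ r₀ := by
    rw [hr₀, le_div_iff₀ hpos, one_mul]
    calc ‖y - q‖ = ‖(y - x₀) - (q - x₀)‖ := by rw [sub_sub_sub_cancel_right]
      _ ≤ ‖y - x₀‖ + ‖q - x₀‖ := norm_sub_le _ _
      _ ≤ _ := by linarith
  have hc : Continuous fun r : ℝ => ‖AffineMap.lineMap q y r - x₀‖ := by
    simp only [AffineMap.lineMap_apply_module']; fun_prop
  have hend : ρ ≤ ‖AffineMap.lineMap q y r₀ - x₀‖ := by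
    have h2 : AffineMap.lineMap q y r₀ - x₀ = r₀ • (y - q) - (x₀ - q) := by
      rw [AffineMap.lineMap_apply_module']; abel
    have h3 : ‖r₀ • (y - q)‖ = ρ + ‖q - x₀‖ := by
      rw [norm_smul, Real.norm_of_nonneg (by linarith), hr₀, div_mul_cancel₀ _ hpos.ne']
    have h4 := norm_sub_norm_le (r₀ • (y - q)) (x₀ - q)
    rw [← h2, h3, norm_sub_rev x₀ q] at h4
    linarith
  obtain ⟨r, hr, hr'⟩ := intermediate_value_Icc h1 hc.continuousOn
    (show ρ ∈ Set.Icc _ _ from ⟨by simpa using hy, hend⟩)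
  exact ⟨r, hr.1, hr'⟩

/-- If a compact convex set lies in a ball, the boundary of its section by an affine subspace is
at most as long as the boundary of the section of the ball. -/
theorem hausdorffMeasure_relBoundary_le [FiniteDimensional ℝ F] [MeasurableSpace F] [BorelSpace F]
    {K : Set F} (hK : IsCompact K) (hconv : Convex ℝ K) (E : AffineSubspace ℝ F) {x₀ : F} {ρ : ℝ}
    (hKρ : K ⊆ Metric.closedBall x₀ ρ) :
    Measure.hausdorffMeasure 1 {p | p ∈ E ∧ p ∈ K ∧ p ∈ closure ((E : Set F) \ K)}
      ≤ Measure.hausdorffMeasure 1 ((E : Set F) ∩ Metric.sphere x₀ ρ) := by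
  have hEc : IsClosed (E : Set F) := E.closed_of_finiteDimensional
  rcases (K ∩ E).eq_empty_or_nonempty with hempty | hne
  · have : {p | p ∈ E ∧ p ∈ K ∧ p ∈ closure ((E : Set F) \ K)} = ∅ :=
      Set.eq_empty_of_forall_notMem fun p hp => Set.eq_empty_iff_forall_notMem.1 hempty p
        ⟨hp.2.1, hp.1⟩
    rw [this, measure_empty]
    exact zero_le
  obtain ⟨P, hPlip, hPS, hP, hPuniq⟩ := exists_convexProjection hne
    (hK.inter_right hEc).isComplete (hconv.inter E.convex)
  have hfix : ∀ p ∈ K ∩ E, P p = p := fun p hp => hPuniq p p hp (by simp)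
  have hcomp : IsCompact (P '' ((E : Set F) ∩ Metric.sphere x₀ ρ)) :=
    ((isCompact_sphere x₀ ρ).inter_left hEc).image hPlip.continuous
  -- The projection of the sphere's section covers the relative boundary of the section of `K`. The
  -- image is closed, so approximating each boundary point is enough.
  have hsub : {p | p ∈ E ∧ p ∈ K ∧ p ∈ closure ((E : Set F) \ K)}
      ⊆ P '' ((E : Set F) ∩ Metric.sphere x₀ ρ) := by
    rintro p ⟨hpE, hpK, hpc⟩
    have hpρ : ‖p - x₀‖ ≤ ρ := by simpa [dist_eq_norm] using hKρ hpK
    rcases hpρ.eq_or_lt with heq | hlt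
    · exact ⟨p, ⟨hpE, by simpa [dist_eq_norm] using heq⟩, hfix p ⟨hpK, hpE⟩⟩
    rw [← hcomp.isClosed.closure_eq, Metric.mem_closure_iff]
    intro ε hε
    -- The second term of the minimum keeps `y` inside the ball, so that the ray from `P y` through
    -- `y` can be prolonged to the sphere.
    obtain ⟨y, ⟨hyE, hyK⟩, hy⟩ := Metric.mem_closure_iff.1 hpc (min ε (ρ - ‖p - x₀‖))
      (lt_min hε (by linarith))
    have hyρ : ‖y - x₀‖ ≤ ρ := by
      have h1 := hy.trans_le (min_le_right _ _)
      rw [dist_comm, dist_eq_norm] at h1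
      calc ‖y - x₀‖ = ‖(y - p) + (p - x₀)‖ := by rw [sub_add_sub_cancel]
        _ ≤ ‖y - p‖ + ‖p - x₀‖ := norm_add_le _ _
        _ ≤ ρ := by linarith
    refine ⟨P y, ?_, ?_⟩
    · have hPy := hPS y
      have hne' : y ≠ P y := fun h => hyK (h ▸ hPy.1)
      obtain ⟨r, hr, hrρ⟩ := exists_norm_lineMap_sub_eq hne' hyρ
      refine ⟨AffineMap.lineMap (P y) y r, ⟨AffineMap.lineMap_mem r hPy.2 hyE,
        by simpa [dist_eq_norm] using hrρ⟩, hPuniq _ _ hPy fun w hw => ?_⟩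
      -- All points of the ray from `P y` through `y` project to `P y`, since their offsets are
      -- nonnegative multiples of `y - P y`.
      rw [AffineMap.lineMap_apply_module', add_sub_cancel_right, inner_smul_left]
      exact mul_nonpos_of_nonneg_of_nonpos (by simpa using by linarith) (hP y w hw)
    · have h1 := hPlip.dist_le_mul p y
      rw [hfix p ⟨hpK, hpE⟩, NNReal.coe_one, one_mul] at h1
      exact h1.trans_lt (hy.trans_le (min_le_left _ _))
  refine (measure_mono hsub).trans ?_
  simpa using (hPlip.lipschitzOnWith
    (s := (E : Set F) ∩ Metric.sphere x₀ ρ)).hausdorffMeasure_image_le zero_le_one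

end Projection

/-! ### Plane sections -/

theorem mem_planeOf {q : S2 × ℝ} {x : E3} :
    x ∈ (planeOf q).1 ↔ inner ℝ (q.1 : E3) x = q.2 := by
  have hq : ‖(q.1 : E3)‖ = 1 := by simp
  rw [planeOf, AffineSubspace.mem_mk', Submodule.mem_orthogonal_singleton_iff_inner_right,
    vsub_eq_sub, inner_sub_right, inner_smul_right, real_inner_self_eq_norm_sq, hq]
  simp [sub_eq_zero]

/-- Replaces the frontier in the subtype by the ambient description used in
`hausdorffMeasure_relBoundary_le`. -/
theorem sectionBoundary_eq (K : ConvexBody E3) (E : AffinePlane) :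
    sectionBoundary K E
      = {p | p ∈ E.1 ∧ p ∈ (K : Set E3) ∧ p ∈ closure ((E.1 : Set E3) \ K)} := by
  have hcl : IsClosed (((↑) : E.1 → E3) ⁻¹' (K : Set E3)) :=
    K.isCompact.isClosed.preimage continuous_subtype_val
  have himg : ((↑) : E.1 → E3) '' (((↑) : E.1 → E3) ⁻¹' (K : Set E3))ᶜ
      = (E.1 : Set E3) \ K := by
    ext x
    constructor
    · rintro ⟨y, hy, rfl⟩
      exact ⟨y.2, hy⟩
    · rintro ⟨hx, hxK⟩
      exact ⟨⟨x, hx⟩, hxK, rfl⟩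
  ext p
  constructor
  · rintro ⟨⟨p, hpE⟩, hp, rfl⟩
    rw [frontier_eq_closure_inter_closure, hcl.closure_eq] at hp
    refine ⟨hpE, hp.1, ?_⟩
    have := closure_subtype.1 hp.2
    rwa [himg] at this
  · rintro ⟨hpE, hpK, hpc⟩
    refine ⟨⟨p, hpE⟩, ?_, rfl⟩
    rw [frontier_eq_closure_inter_closure, hcl.closure_eq]
    refine ⟨hpK, closure_subtype.2 ?_⟩
    rwa [himg]

theorem exists_orthonormalBasis_apply_zero_eq (u : S2) :
    ∃ b : OrthonormalBasis (Fin 3) ℝ E3, b 0 = u := by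
  have hu : ‖(u : E3)‖ = 1 := by simp
  have hv : Orthonormal ℝ (Set.domRestrict ({0} : Set (Fin 3)) fun _ => (u : E3)) :=
    ⟨fun _ => hu, fun i j hij => (hij (Subsingleton.elim i j)).elim⟩
  obtain ⟨b, hb⟩ := hv.exists_orthonormalBasis_extension_of_card_eq (by simp)
  exact ⟨b, hb 0 rfl⟩

theorem exists_eq_mul_cos_sin {p q s : ℝ} (h : p ^ 2 + q ^ 2 = s ^ 2) (hs : 0 ≤ s) :
    ∃ θ ∈ Set.Icc (-Real.pi) Real.pi, p = s * Real.cos θ ∧ q = s * Real.sin θ := by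
  have hn : ‖(⟨p, q⟩ : ℂ)‖ = s := by
    rw [Complex.norm_def, Complex.normSq_mk, ← sq, ← sq, h, Real.sqrt_sq hs]
  refine ⟨Complex.arg ⟨p, q⟩, ⟨(Complex.neg_pi_lt_arg _).le, Complex.arg_le_pi _⟩, ?_, ?_⟩
  · rw [← hn, Complex.norm_mul_cos_arg]
  · rw [← hn, Complex.norm_mul_sin_arg]

/-- A plane meeting a ball meets the bounding sphere in a circle. -/
theorem exists_circleCurve_of_planeOf (u : S2) {t : ℝ} {x₀ : E3} {ρ : ℝ} (hρ : 0 ≤ ρ)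
    (h : (t - inner ℝ (u : E3) x₀) ^ 2 ≤ ρ ^ 2) :
    ∃ m e₁ e₂ : E3, ‖e₁‖ = 1 ∧ ‖e₂‖ = 1 ∧ inner ℝ e₁ e₂ = 0 ∧
      ((planeOf (u, t)).1 : Set E3) ∩ Metric.sphere x₀ ρ
        ⊆ circleCurve m e₁ e₂ (√(ρ ^ 2 - (t - inner ℝ (u : E3) x₀) ^ 2)) ''
          Set.Icc (-Real.pi) Real.pi ∧
      ∀ θ, circleCurve m e₁ e₂ (√(ρ ^ 2 - (t - inner ℝ (u : E3) x₀) ^ 2)) θ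
        ∈ ((planeOf (u, t)).1 : Set E3) ∩ Metric.sphere x₀ ρ := by
  obtain ⟨b, hb⟩ := exists_orthonormalBasis_apply_zero_eq u
  have hbi : ∀ i j, inner ℝ (b i) (b j) = if i = j then (1 : ℝ) else 0 := fun i j =>
    orthonormal_iff_ite.1 b.orthonormal i j
  set τ := t - inner ℝ (u : E3) x₀ with hτ
  set s := √(ρ ^ 2 - τ ^ 2) with hs
  have hs2 : s ^ 2 = ρ ^ 2 - τ ^ 2 := Real.sq_sqrt (by linarith)
  have hexp : ∀ v : E3, v = inner ℝ (b 0) v • b 0 + inner ℝ (b 1) v • b 1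
      + inner ℝ (b 2) v • b 2 := fun v => by
    conv_lhs => rw [← b.sum_repr' v, Fin.sum_univ_three]
  have hnorm : ∀ c₀ c₁ c₂ : ℝ, ‖c₀ • b 0 + c₁ • b 1 + c₂ • b 2‖ ^ 2
      = c₀ ^ 2 + c₁ ^ 2 + c₂ ^ 2 := by
    intro c₀ c₁ c₂
    rw [← real_inner_self_eq_norm_sq]
    simp only [inner_add_left, inner_add_right, inner_smul_left, inner_smul_right, hbi]
    simp
    ring
  refine ⟨x₀ + τ • b 0, b 1, b 2, b.orthonormal.1 1, b.orthonormal.1 2, by simp [hbi], ?_, ?_⟩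
  · rintro x ⟨hxE, hxS⟩
    have hx0 : inner ℝ (b 0) (x - x₀) = τ := by
      rw [hb, inner_sub_right, mem_planeOf.1 hxE]
    have hxn : ‖x - x₀‖ ^ 2 = ρ ^ 2 := by
      rw [← dist_eq_norm, Metric.mem_sphere.1 hxS]
    have hx := hexp (x - x₀)
    rw [hx0] at hx
    rw [hx, hnorm] at hxn
    obtain ⟨θ, hθ, hc, hsn⟩ := exists_eq_mul_cos_sin
      (show inner ℝ (b 1) (x - x₀) ^ 2 + inner ℝ (b 2) (x - x₀) ^ 2 = s ^ 2 by linarith)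
      (Real.sqrt_nonneg _)
    refine ⟨θ, hθ, ?_⟩
    rw [circleCurve, ← hc, ← hsn, add_assoc x₀, add_assoc x₀, ← hx]
    abel
  · intro θ
    have hx : circleCurve (x₀ + τ • b 0) (b 1) (b 2) s θ
        = x₀ + (τ • b 0 + (s * Real.cos θ) • b 1 + (s * Real.sin θ) • b 2) := by
      simp only [circleCurve, add_assoc]
    constructor
    · refine mem_planeOf.2 ?_
      rw [hx, ← hb]
      simp only [inner_add_right, inner_smul_right, hbi]
      simp [hτ, hb]
    · rw [Metric.mem_sphere, dist_eq_norm, hx, add_sub_cancel_left]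
      refine (sq_eq_sq₀ (norm_nonneg _) hρ).1 ?_
      rw [hnorm]
      linear_combination s ^ 2 * Real.sin_sq_add_cos_sq θ + hs2

theorem sectionLength_le {K : ConvexBody E3} {x₀ : E3} {ρ : ℝ}
    (hKρ : (K : Set E3) ⊆ Metric.closedBall x₀ ρ) (u : S2) (t : ℝ) :
    sectionLength K (planeOf (u, t))
      ≤ ENNReal.ofReal (2 * Real.pi * √(ρ ^ 2 - (t - inner ℝ (u : E3) x₀) ^ 2)) := by
  rw [sectionLength, sectionBoundary_eq]
  refine (hausdorffMeasure_relBoundary_le K.isCompact K.convex _ hKρ).trans ?_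
  have hρ : 0 ≤ ρ := by
    obtain ⟨x, hx⟩ := K.nonempty
    exact dist_nonneg.trans (Metric.mem_closedBall.1 (hKρ hx))
  by_cases h : (t - inner ℝ (u : E3) x₀) ^ 2 ≤ ρ ^ 2
  · obtain ⟨m, e₁, e₂, h₁, h₂, h₁₂, hsub, -⟩ := exists_circleCurve_of_planeOf u hρ h
    exact (measure_mono hsub).trans
      (hausdorffMeasure_circleCurve_le (Real.sqrt_nonneg _) h₁ h₂ h₁₂)
  · have : ((planeOf (u, t)).1 : Set E3) ∩ Metric.sphere x₀ ρ = ∅ := by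
      refine Set.eq_empty_of_forall_notMem fun x hx => h ?_
      have hu : ‖(u : E3)‖ = 1 := by simp
      have h1 := abs_real_inner_le_norm (u : E3) (x - x₀)
      rw [inner_sub_right, mem_planeOf.1 hx.1, hu, one_mul, ← dist_eq_norm,
        Metric.mem_sphere.1 hx.2] at h1
      exact sq_le_sq' (abs_le.1 h1).1 (abs_le.1 h1).2
    rw [this, measure_empty]
    exact zero_le

/-- The sections of a ball are discs. -/
theorem sectionLength_eq_of_closedBall {K : ConvexBody E3} {x₀ : E3} {ρ : ℝ}
    (hKρ : (K : Set E3) = Metric.closedBall x₀ ρ) (u : S2) (t : ℝ) :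
    sectionLength K (planeOf (u, t))
      = ENNReal.ofReal (2 * Real.pi * √(ρ ^ 2 - (t - inner ℝ (u : E3) x₀) ^ 2)) := by
  refine le_antisymm (sectionLength_le hKρ.subset u t) ?_
  have hρ : 0 ≤ ρ := by
    obtain ⟨x, hx⟩ := K.nonempty
    exact dist_nonneg.trans (Metric.mem_closedBall.1 (hKρ.subset hx))
  rcases le_or_gt (ρ ^ 2 - (t - inner ℝ (u : E3) x₀) ^ 2) 0 with h | h
  · rw [Real.sqrt_eq_zero_of_nonpos h]
    simp
  obtain ⟨m, e₁, e₂, h₁, h₂, h₁₂, -, hmem⟩ :=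
    exists_circleCurve_of_planeOf u hρ (t := t) (x₀ := x₀) (by linarith)
  refine (le_hausdorffMeasure_circleCurve (m := m) (Real.sqrt_pos.2 h) h₁ h₂ h₁₂).trans ?_
  rw [sectionLength, sectionBoundary_eq]
  refine measure_mono ?_
  rintro _ ⟨θ, -, rfl⟩
  obtain ⟨hpE, hpS⟩ := hmem θ
  set p := circleCurve m e₁ e₂ (√(ρ ^ 2 - (t - inner ℝ (u : E3) x₀) ^ 2)) θ
  have hu : ‖(u : E3)‖ = 1 := by simp
  have hup := mem_planeOf.1 hpE
  simp only at hup
  refine ⟨hpE, hKρ.superset (Metric.sphere_subset_closedBall hpS), ?_⟩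
  set τ := t - inner ℝ (u : E3) x₀ with hτ
  -- the component of `p - x₀` in the plane, along which one leaves the ball
  set v := p - x₀ - τ • (u : E3) with hv
  have huv : inner ℝ (u : E3) v = 0 := by
    rw [hv, inner_sub_right, inner_sub_right, hup, inner_smul_right, real_inner_self_eq_norm_sq,
      hu, hτ]
    ring
  have hpn : ‖p - x₀‖ ^ 2 = ρ ^ 2 := by rw [← dist_eq_norm, Metric.mem_sphere.1 hpS]
  have hpv : inner ℝ (p - x₀) v = ρ ^ 2 - τ ^ 2 := by
    conv_lhs => rw [hv]
    rw [inner_sub_right, real_inner_self_eq_norm_sq, inner_smul_right, real_inner_comm,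
      inner_sub_right, hup, hpn, hτ]
    ring
  have hlim : Filter.Tendsto (fun ε : ℝ => p + ε • v) (nhdsWithin 0 (Set.Ioi 0)) (nhds p) := by
    have : Continuous fun ε : ℝ => p + ε • v := by fun_prop
    simpa using (this.tendsto 0).mono_left nhdsWithin_le_nhds
  -- For `ε > 0` the point `p + ε • v` has squared distance at least `ρ² + 2ε(ρ² - τ²) > ρ²` from
  -- `x₀`, so it lies in the plane but outside the ball.
  refine mem_closure_of_tendsto hlim ?_
  filter_upwards [self_mem_nhdsWithin] with ε hε
  have hε : 0 < ε := hε
  refine ⟨mem_planeOf.2 ?_, fun hmemK => ?_⟩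
  · rw [inner_add_right, inner_smul_right, huv]
    simpa using hup
  · have h1 := hKρ.subset hmemK
    rw [Metric.mem_closedBall, dist_eq_norm, add_sub_right_comm] at h1
    have h2 := pow_le_pow_left₀ (norm_nonneg _) h1 2
    rw [norm_add_sq_real, inner_smul_right, hpv, hpn] at h2
    nlinarith [sq_nonneg ‖ε • v‖, mul_pos hε h]


/-! ### Support function, inradius and circumradius -/

theorem inner_le_supportFun {K : ConvexBody E3} (u : E3) {x : E3} (hx : x ∈ (K : Set E3)) :
    inner ℝ u x ≤ supportFun K u :=
  le_csSup (K.isCompact.image (by fun_prop : Continuous fun x : E3 => inner ℝ u x)).bddAbove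
    ⟨x, hx, rfl⟩

theorem supportFun_le {K : ConvexBody E3} {u : E3} {c : ℝ}
    (h : ∀ x ∈ (K : Set E3), inner ℝ u x ≤ c) : supportFun K u ≤ c :=
  csSup_le (K.nonempty.image _) (by rintro _ ⟨x, hx, rfl⟩; exact h x hx)

theorem continuous_supportFun (K : ConvexBody E3) : Continuous (supportFun K) :=
  K.isCompact.continuous_sSup (f := fun u x : E3 => inner ℝ u x)
    (continuous_fst.inner continuous_snd)

theorem supportFun_le_of_subset_closedBall {K : ConvexBody E3} {x : E3} {ρ : ℝ}
    (h : (K : Set E3) ⊆ Metric.closedBall x ρ) {u : E3} (hu : ‖u‖ = 1) :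
    supportFun K u ≤ inner ℝ u x + ρ := by
  refine supportFun_le fun y hy => ?_
  have h1 := real_inner_le_norm u (y - x)
  have h2 := h hy
  rw [Metric.mem_closedBall, dist_eq_norm] at h2
  rw [inner_sub_right, hu, one_mul] at h1
  linarith

theorem le_supportFun_of_closedBall_subset {K : ConvexBody E3} {x : E3} {ρ : ℝ} (hρ : 0 ≤ ρ)
    (h : Metric.closedBall x ρ ⊆ (K : Set E3)) {u : E3} (hu : ‖u‖ = 1) :
    inner ℝ u x + ρ ≤ supportFun K u := by
  have hmem : x + ρ • u ∈ Metric.closedBall x ρ := by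
    simp [norm_smul, hu, abs_of_nonneg hρ]
  have := inner_le_supportFun u (h hmem)
  rwa [inner_add_right, inner_smul_right, real_inner_self_eq_norm_sq, hu, one_pow, mul_one] at this

section ConstantWidth

variable {K : ConvexBody E3} {a : ℝ}

theorem HasConstantWidth.supportFun_add (hK : HasConstantWidth K a) {u : E3} (hu : ‖u‖ = 1) :
    supportFun K u + supportFun K (-u) = a :=
  hK ⟨u, by simpa using hu⟩

theorem exists_norm_eq_one : ∃ u : E3, ‖u‖ = 1 :=
  ⟨EuclideanSpace.single 0 1, by simp⟩

theorem HasConstantWidth.le_two_mul (hK : HasConstantWidth K a) {x : E3} {ρ : ℝ}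
    (h : (K : Set E3) ⊆ Metric.closedBall x ρ) : a ≤ 2 * ρ := by
  obtain ⟨u, hu⟩ := exists_norm_eq_one
  have h1 := supportFun_le_of_subset_closedBall h hu
  have h2 := supportFun_le_of_subset_closedBall h (u := -u) (by rwa [norm_neg])
  rw [inner_neg_left] at h2
  linarith [hK.supportFun_add hu]

theorem HasConstantWidth.two_mul_le (hK : HasConstantWidth K a) {x : E3} {ρ : ℝ} (hρ : 0 ≤ ρ)
    (h : Metric.closedBall x ρ ⊆ (K : Set E3)) : 2 * ρ ≤ a := by
  obtain ⟨u, hu⟩ := exists_norm_eq_one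
  have h1 := le_supportFun_of_closedBall_subset hρ h hu
  have h2 := le_supportFun_of_closedBall_subset hρ h (u := -u) (by rwa [norm_neg])
  rw [inner_neg_left] at h2
  linarith [hK.supportFun_add hu]

/-- The width in the direction of `x - y` is at least `‖x - y‖`. This is the diameter bound fed to
Jung's theorem. -/
theorem HasConstantWidth.norm_sub_le (hK : HasConstantWidth K a) (ha : 0 ≤ a) {x y : E3}
    (hx : x ∈ (K : Set E3)) (hy : y ∈ (K : Set E3)) : ‖x - y‖ ≤ a := by
  rcases eq_or_ne (x - y) 0 with h | h
  · rwa [h, norm_zero]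
  have hu : ‖(‖x - y‖⁻¹ • (x - y))‖ = 1 := norm_smul_inv_norm (𝕜 := ℝ) h
  have h1 := inner_le_supportFun (‖x - y‖⁻¹ • (x - y)) hx
  have h2 := inner_le_supportFun (-(‖x - y‖⁻¹ • (x - y))) hy
  have h3 : inner ℝ (‖x - y‖⁻¹ • (x - y)) (x - y) = ‖x - y‖ := by
    rw [inner_smul_left, real_inner_self_eq_norm_sq, conj_trivial]
    field_simp
  rw [inner_sub_right] at h3
  rw [inner_neg_left] at h2
  linarith [hK.supportFun_add hu]

/-- A ball contained in a body of constant width `a` has a concentric ball containing the body,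
the radii adding up to `a`. -/
theorem HasConstantWidth.subset_closedBall_sub (hK : HasConstantWidth K a) {x : E3} {ρ : ℝ}
    (hρ : 0 ≤ ρ) (h : Metric.closedBall x ρ ⊆ (K : Set E3)) :
    (K : Set E3) ⊆ Metric.closedBall x (a - ρ) := by
  intro y hy
  rw [Metric.mem_closedBall, dist_eq_norm]
  rcases eq_or_ne (y - x) 0 with h0 | h0
  · rw [h0, norm_zero]
    linarith [hK.two_mul_le hρ h]
  have hu : ‖(‖y - x‖⁻¹ • (y - x))‖ = 1 := norm_smul_inv_norm (𝕜 := ℝ) h0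
  have h1 := inner_le_supportFun (‖y - x‖⁻¹ • (y - x)) hy
  have h2 := le_supportFun_of_closedBall_subset hρ h (u := -(‖y - x‖⁻¹ • (y - x)))
    (by rwa [norm_neg])
  have h3 : inner ℝ (‖y - x‖⁻¹ • (y - x)) (y - x) = ‖y - x‖ := by
    rw [inner_smul_left, real_inner_self_eq_norm_sq, conj_trivial]
    field_simp
  rw [inner_sub_right] at h3
  rw [inner_neg_left] at h2
  linarith [hK.supportFun_add hu]

theorem circumradius_le {x : E3} {ρ : ℝ} (h : (K : Set E3) ⊆ Metric.closedBall x ρ) :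
    circumradius K ≤ ρ := by
  obtain ⟨y, hy⟩ := K.nonempty
  exact csInf_le ⟨0, fun _ h => h.1⟩
    ⟨dist_nonneg.trans (Metric.mem_closedBall.1 (h hy)), x, h⟩

/-- Working with every `ρ` above the circumradius avoids proving that the infimum is attained. -/
theorem exists_subset_closedBall_of_circumradius_lt {ρ : ℝ} (hρ : circumradius K < ρ) :
    ∃ x : E3, (K : Set E3) ⊆ Metric.closedBall x ρ := by
  obtain ⟨ρ₀, hρ₀⟩ := K.isCompact.isBounded.subset_closedBall (0 : E3)
  obtain ⟨y, hy⟩ := K.nonempty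
  have hne : {ρ : ℝ | 0 ≤ ρ ∧ ∃ x : E3, (K : Set E3) ⊆ Metric.closedBall x ρ}.Nonempty :=
    ⟨ρ₀, dist_nonneg.trans (Metric.mem_closedBall.1 (hρ₀ hy)), 0, hρ₀⟩
  obtain ⟨ρ', ⟨-, x, hx⟩, hlt⟩ := exists_lt_of_csInf_lt hne hρ
  exact ⟨x, hx.trans (Metric.closedBall_subset_closedBall hlt.le)⟩

theorem HasConstantWidth.half_le_circumradius (hK : HasConstantWidth K a) :
    a / 2 ≤ circumradius K := by
  refine le_of_forall_gt_imp_ge_of_dense fun ρ hρ => ?_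
  obtain ⟨x, hx⟩ := exists_subset_closedBall_of_circumradius_lt hρ
  linarith [hK.le_two_mul hx]

theorem HasConstantWidth.le_inradius (hK : HasConstantWidth K a) {x : E3} {ρ : ℝ} (hρ : 0 ≤ ρ)
    (h : Metric.closedBall x ρ ⊆ (K : Set E3)) : ρ ≤ inradius K :=
  le_csSup ⟨a / 2, by rintro σ ⟨hσ, y, hy⟩; linarith [hK.two_mul_le hσ hy]⟩ ⟨hρ, x, h⟩

theorem inradius_nonneg (K : ConvexBody E3) : 0 ≤ inradius K :=
  Real.sSup_nonneg fun _ h => h.1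

theorem HasConstantWidth.inradius_add_circumradius_le (hK : HasConstantWidth K a) :
    inradius K + circumradius K ≤ a := by
  obtain ⟨y, hy⟩ := K.nonempty
  have hne : {ρ : ℝ | 0 ≤ ρ ∧ ∃ x : E3, Metric.closedBall x ρ ⊆ (K : Set E3)}.Nonempty :=
    ⟨0, le_rfl, y, by simpa using hy⟩
  have : inradius K ≤ a - circumradius K := by
    refine csSup_le hne ?_
    rintro ρ ⟨hρ, x, hx⟩
    linarith [circumradius_le (hK.subset_closedBall_sub hρ hx)]
  linarith

theorem HasConstantWidth.circumradius_sq_le (hK : HasConstantWidth K a) (ha : 0 ≤ a) :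
    circumradius K ^ 2 ≤ 3 / 8 * a ^ 2 := by
  obtain ⟨z, hz⟩ := exists_subset_closedBall_of_diam_le fun x hx y hy => hK.norm_sub_le ha hx hy
  have hR0 : 0 ≤ circumradius K := Real.sInf_nonneg fun _ h => h.1
  have h := pow_le_pow_left₀ hR0 (circumradius_le hz) 2
  have hval : a ^ 2 / 2 * (1 - 1 / ((Module.finrank ℝ E3 : ℝ) + 1)) = 3 / 8 * a ^ 2 := by
    rw [finrank_euclideanSpace_fin]
    norm_num
    ring
  rw [hval, Real.sq_sqrt (by positivity)] at h
  exact h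

/-! ### Integration over the planes -/

theorem measurable_planeOf : Measurable planeOf := fun _ hs => hs

theorem measurable_of_comp_planeOf {f : AffinePlane → ENNReal}
    (hf : Measurable fun q => f (planeOf q)) : Measurable f := fun _ hs => hf hs

theorem toSphere_univ : (volume : Measure E3).toSphere Set.univ = ENNReal.ofReal (4 * Real.pi) := by
  rw [Measure.toSphere_apply_univ, EuclideanSpace.volume_ball_fin_three, finrank_euclideanSpace_fin,
    ENNReal.ofReal_one, one_pow, one_mul, ← ENNReal.ofReal_natCast, ← ENNReal.ofReal_mul (by simp)]
  congr 1
  push_cast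
  ring

theorem setLIntegral_sq_sub_sq {α β κ ρ : ℝ} (hαβ : α ≤ β) (hα : κ - ρ ≤ α) (hβ : β ≤ κ + ρ) :
    ∫⁻ t in Set.Icc α β, ENNReal.ofReal (4 * Real.pi ^ 2 * (ρ ^ 2 - (t - κ) ^ 2))
      = ENNReal.ofReal (4 * Real.pi ^ 2 *
        (ρ ^ 2 * (β - α) - ((β - κ) ^ 3 - (α - κ) ^ 3) / 3)) := by
  have hc : Continuous fun t : ℝ => 4 * Real.pi ^ 2 * (ρ ^ 2 - (t - κ) ^ 2) := by fun_prop
  rw [← ofReal_integral_eq_lintegral_ofReal (hc.integrableOn_Icc)]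
  · congr 1
    rw [integral_Icc_eq_integral_Ioc, ← intervalIntegral.integral_of_le hαβ]
    have hd : ∀ t : ℝ, HasDerivAt
        (fun t : ℝ => 4 * Real.pi ^ 2 * (ρ ^ 2 * t - (t - κ) ^ 3 / 3))
        (4 * Real.pi ^ 2 * (ρ ^ 2 - (t - κ) ^ 2)) t := by
      intro t
      have h1 := (((hasDerivAt_id t).sub_const κ).pow 3).div_const 3
      have h2 := (((hasDerivAt_id t).const_mul (ρ ^ 2)).sub h1).const_mul (4 * Real.pi ^ 2)
      refine h2.congr_deriv ?_
      simp
    rw [intervalIntegral.integral_eq_sub_of_hasDerivAt (fun t _ => hd t)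
      (hc.intervalIntegrable _ _)]
    ring
  · refine (ae_restrict_iff' measurableSet_Icc).2 (Filter.Eventually.of_forall fun t ht => ?_)
    have : (t - κ) ^ 2 ≤ ρ ^ 2 := sq_le_sq' (by linarith [ht.1]) (by linarith [ht.2])
    exact mul_nonneg (by positivity) (sub_nonneg.2 this)

/-- Valid for negative `x` too, where both sides are truncated to `0`; no case split on whether a
plane meets the ball is then needed. -/
theorem ofReal_two_pi_sqrt_sq (x : ℝ) :
    ENNReal.ofReal (2 * Real.pi * √x) ^ 2 = ENNReal.ofReal (4 * Real.pi ^ 2 * x) := by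
  have hπ := Real.pi_pos
  rw [← ENNReal.ofReal_pow (by positivity), mul_pow]
  rcases le_total 0 x with h | h
  · rw [Real.sq_sqrt h]
    congr 1
    ring
  · rw [Real.sqrt_eq_zero_of_nonpos h, ENNReal.ofReal_of_nonpos (by simp),
      ENNReal.ofReal_of_nonpos (mul_nonpos_of_nonneg_of_nonpos (by positivity) h)]

theorem sectionLength_eq_zero_of_notMem {u : S2} {t : ℝ}
    (ht : t ∉ Set.Icc (-supportFun K (-(u : E3))) (supportFun K u)) :
    sectionLength K (planeOf (u, t)) = 0 := by
  have : sectionBoundary K (planeOf (u, t)) = ∅ := by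
    refine Set.eq_empty_of_forall_notMem fun p hp => ht ?_
    rw [sectionBoundary_eq] at hp
    have h0 : inner ℝ (u : E3) p = t := mem_planeOf.1 hp.1
    have h1 := inner_le_supportFun (u : E3) hp.2.1
    have h2 := inner_le_supportFun (-(u : E3)) hp.2.1
    rw [inner_neg_left] at h2
    exact ⟨by linarith, by linarith⟩
  rw [sectionLength, this, measure_empty]

theorem HasConstantWidth.lintegral_le_of_subset_closedBall (hK : HasConstantWidth K a)
    (ha : 0 ≤ a) {x₀ : E3} {ρ : ℝ} (hKρ : (K : Set E3) ⊆ Metric.closedBall x₀ ρ) :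
    ∫⁻ E : AffinePlane, sectionLength K E ^ 2 ∂planeMeasure
      ≤ ENNReal.ofReal (8 * Real.pi ^ 3 * (a * ρ ^ 2 - a ^ 3 / 12)) := by
  -- Contains every pair whose plane meets `K`. Cutting off at the support planes of `K`, rather
  -- than of the ball, makes the interval length exactly `a`.
  let A : Set (S2 × ℝ) :=
    {q | -supportFun K (-(q.1 : E3)) ≤ q.2} ∩ {q | q.2 ≤ supportFun K (q.1 : E3)}
  have hcont := continuous_supportFun K
  have hA : MeasurableSet A :=
    ((isClosed_le (by fun_prop) (by fun_prop)).inter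
      (isClosed_le (by fun_prop) (by fun_prop))).measurableSet
  let g : S2 × ℝ → ENNReal := A.indicator fun q =>
    ENNReal.ofReal (4 * Real.pi ^ 2 * (ρ ^ 2 - (q.2 - inner ℝ (q.1 : E3) x₀) ^ 2))
  have hg : Measurable g := by
    refine Measurable.indicator (Measurable.ennreal_ofReal (Continuous.measurable ?_)) hA
    fun_prop
  have hfg : ∀ q, sectionLength K (planeOf q) ^ 2 ≤ g q := by
    rintro ⟨u, t⟩
    by_cases hq : (u, t) ∈ A
    · simp only [g, Set.indicator_of_mem hq]
      rw [← ofReal_two_pi_sqrt_sq]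
      exact pow_le_pow_left₀ zero_le (sectionLength_le hKρ u t) 2
    · rw [sectionLength_eq_zero_of_notMem fun ht => hq ht]
      simp
  have hinner : ∀ u : S2, ∫⁻ t, g (u, t)
      ≤ ENNReal.ofReal (4 * Real.pi ^ 2 * (a * ρ ^ 2 - a ^ 3 / 12)) := by
    intro u
    have hu : ‖(u : E3)‖ = 1 := by simp
    have hind : ∀ t, g (u, t)
        = (Set.Icc (-supportFun K (-(u : E3))) (supportFun K u)).indicator (fun t =>
          ENNReal.ofReal (4 * Real.pi ^ 2 * (ρ ^ 2 - (t - inner ℝ (u : E3) x₀) ^ 2))) t :=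
      fun t => rfl
    have h1 := supportFun_le_of_subset_closedBall hKρ hu
    have h2 := supportFun_le_of_subset_closedBall hKρ (u := -(u : E3)) (by rwa [norm_neg])
    have h3 := hK.supportFun_add hu
    rw [inner_neg_left] at h2
    simp_rw [hind]
    rw [lintegral_indicator measurableSet_Icc,
      setLIntegral_sq_sub_sq (by linarith) (by linarith) (by linarith)]
    refine ENNReal.ofReal_le_ofReal (mul_le_mul_of_nonneg_left ?_ (by positivity))
    set κ := inner ℝ (u : E3) x₀
    set β := supportFun K (u : E3)
    have h4 : supportFun K (-(u : E3)) = a - β := by linarith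
    rw [h4]
    -- The second moment of the interval about `κ` equals `a³/12 + a(β - κ - a/2)²`.
    nlinarith [mul_nonneg ha (sq_nonneg (β - κ - a / 2))]
  calc ∫⁻ E : AffinePlane, sectionLength K E ^ 2 ∂planeMeasure
      ≤ ∫⁻ q, sectionLength K (planeOf q) ^ 2
          ∂((2 : ENNReal)⁻¹ • ((volume : Measure E3).toSphere.prod (volume : Measure ℝ))) :=
        -- This inequality needs no measurability of the section length.
        lintegral_map_le _ _
    _ ≤ ∫⁻ q, g q
          ∂((2 : ENNReal)⁻¹ • ((volume : Measure E3).toSphere.prod (volume : Measure ℝ))) :=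
        lintegral_mono hfg
    _ = 2⁻¹ * ∫⁻ u, (∫⁻ t, g (u, t)) ∂(volume : Measure E3).toSphere := by
        rw [lintegral_smul_measure, lintegral_prod _ hg.aemeasurable, smul_eq_mul]
    _ ≤ 2⁻¹ * ∫⁻ _u, ENNReal.ofReal (4 * Real.pi ^ 2 * (a * ρ ^ 2 - a ^ 3 / 12))
          ∂(volume : Measure E3).toSphere := by
        gcongr with u
        exact hinner u
    _ = ENNReal.ofReal (8 * Real.pi ^ 3 * (a * ρ ^ 2 - a ^ 3 / 12)) := by
        rw [lintegral_const, toSphere_univ, mul_comm (ENNReal.ofReal _),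
          ← ENNReal.ofReal_mul (by positivity), ← ENNReal.ofReal_ofNat 2,
          ← ENNReal.ofReal_inv_of_pos (by norm_num), ← ENNReal.ofReal_mul (by norm_num)]
        congr 1
        ring

theorem HasConstantWidth.lintegral_le_circumradius (hK : HasConstantWidth K a) (ha : 0 ≤ a) :
    ∫⁻ E : AffinePlane, sectionLength K E ^ 2 ∂planeMeasure
      ≤ ENNReal.ofReal (8 * Real.pi ^ 3 * (a * circumradius K ^ 2 - a ^ 3 / 12)) := by
  have hc : Continuous fun ρ : ℝ =>
      ENNReal.ofReal (8 * Real.pi ^ 3 * (a * ρ ^ 2 - a ^ 3 / 12)) :=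
    ENNReal.continuous_ofReal.comp (by fun_prop)
  refine ge_of_tendsto ((hc.tendsto (circumradius K)).mono_left
    (nhdsWithin_le_nhds (s := Set.Ioi (circumradius K)))) ?_
  filter_upwards [self_mem_nhdsWithin] with ρ hρ
  obtain ⟨x, hx⟩ := exists_subset_closedBall_of_circumradius_lt hρ
  exact hK.lintegral_le_of_subset_closedBall ha hx

theorem le_lintegral_of_closedBall {x₀ : E3} {ρ : ℝ} (hρ : 0 ≤ ρ)
    (hKρ : (K : Set E3) = Metric.closedBall x₀ ρ) :
    ENNReal.ofReal (32 / 3 * Real.pi ^ 3 * ρ ^ 3)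
      ≤ ∫⁻ E : AffinePlane, sectionLength K E ^ 2 ∂planeMeasure := by
  let g : S2 × ℝ → ENNReal := fun q =>
    ENNReal.ofReal (4 * Real.pi ^ 2 * (ρ ^ 2 - (q.2 - inner ℝ (q.1 : E3) x₀) ^ 2))
  have hg : Measurable g := by
    refine Measurable.ennreal_ofReal (Continuous.measurable ?_)
    fun_prop
  have hfg : ∀ q, sectionLength K (planeOf q) ^ 2 = g q := by
    rintro ⟨u, t⟩
    rw [sectionLength_eq_of_closedBall hKρ, ofReal_two_pi_sqrt_sq]
  -- For a ball the explicit formula makes the section length measurable, so the integral can be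
  -- transferred to `S2 × ℝ` with equality.
  have hf : Measurable fun E : AffinePlane => sectionLength K E ^ 2 :=
    measurable_of_comp_planeOf (by simpa only [hfg] using hg)
  have hinner : ∀ u : S2, ENNReal.ofReal (16 / 3 * Real.pi ^ 2 * ρ ^ 3) ≤ ∫⁻ t, g (u, t) := by
    intro u
    refine le_trans (le_of_eq ?_) (setLIntegral_le_lintegral
      (Set.Icc (inner ℝ (u : E3) x₀ - ρ) (inner ℝ (u : E3) x₀ + ρ)) _)
    rw [setLIntegral_sq_sub_sq (by linarith) le_rfl le_rfl]
    congr 1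
    ring
  rw [planeMeasure, lintegral_map hf measurable_planeOf, lintegral_smul_measure]
  simp_rw [hfg]
  rw [lintegral_prod _ hg.aemeasurable, smul_eq_mul]
  refine le_trans (le_of_eq ?_) (mul_le_mul_right (lintegral_mono hinner) _)
  rw [lintegral_const, toSphere_univ, mul_comm (ENNReal.ofReal (16 / 3 * _ * _)),
    ← ENNReal.ofReal_mul (by positivity), ← ENNReal.ofReal_ofNat 2,
    ← ENNReal.ofReal_inv_of_pos (by norm_num), ← ENNReal.ofReal_mul (by norm_num)]
  congr 1
  ring

end ConstantWidth

end

/-! ### Conclusion: estimates of the circumradius and the case of a ball -/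

theorem theorem3p1 (K : ConvexBody E3) (a c : ℝ) (ha : 0 < a)
    (hK : HasConstantWidth K a) (hc : c = inradius K / circumradius K) :
    (∫⁻ E : AffinePlane, sectionLength K E ^ 2 ∂planeMeasure
      ≤ ENNReal.ofReal (8 * Real.pi ^ 3 * a ^ 3 * (1 / (1 + c) ^ 2 - 1 / 12))) ∧
    ((∃ (x : E3) (ρ : ℝ), (K : Set E3) = Metric.closedBall x ρ) →
      ∫⁻ E : AffinePlane, sectionLength K E ^ 2 ∂planeMeasure
        = ENNReal.ofReal (8 * Real.pi ^ 3 * a ^ 3 * (1 / (1 + c) ^ 2 - 1 / 12))) ∧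
    (∫⁻ E : AffinePlane, sectionLength K E ^ 2 ∂planeMeasure
      ≤ ENNReal.ofReal (7 / 3 * Real.pi ^ 3 * a ^ 3)) := by
  have hR := hK.half_le_circumradius
  have hR0 : 0 < circumradius K := by linarith
  have hr0 := inradius_nonneg K
  have hrR := hK.inradius_add_circumradius_le
  have hmain := hK.lintegral_le_circumradius ha.le
  have hπ := Real.pi_pos
  have hfirst : ∫⁻ E : AffinePlane, sectionLength K E ^ 2 ∂planeMeasure
      ≤ ENNReal.ofReal (8 * Real.pi ^ 3 * a ^ 3 * (1 / (1 + c) ^ 2 - 1 / 12)) := by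
    refine hmain.trans (ENNReal.ofReal_le_ofReal ?_)
    have h1c : 1 + c = (inradius K + circumradius K) / circumradius K := by
      rw [hc]; field_simp; ring
    -- Since `1/(1 + c) = R/(r + R)`, this is `r + R ≤ a`.
    have hsq : circumradius K ^ 2 / a ^ 2 ≤ 1 / (1 + c) ^ 2 := by
      rw [h1c, div_pow, one_div_div]
      gcongr
    have : 8 * Real.pi ^ 3 * (a * circumradius K ^ 2 - a ^ 3 / 12)
        = 8 * Real.pi ^ 3 * a ^ 3 * (circumradius K ^ 2 / a ^ 2 - 1 / 12) := by
      field_simp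
    rw [this]
    gcongr
  refine ⟨hfirst, ?_, hmain.trans (ENNReal.ofReal_le_ofReal ?_)⟩
  · rintro ⟨x, ρ, hKρ⟩
    refine le_antisymm hfirst ?_
    obtain ⟨y, hy⟩ := K.nonempty
    have hρ : 0 ≤ ρ := dist_nonneg.trans (Metric.mem_closedBall.1 (hKρ.subset hy))
    have h1 := hK.le_two_mul hKρ.subset
    have h2 := hK.two_mul_le hρ hKρ.superset
    have h3 := hK.le_inradius hρ hKρ.superset
    -- Both width comparisons give `a = 2ρ`, so `R ≥ a/2` and `r + R ≤ a` force `r = R = ρ`.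
    have hRρ : circumradius K = ρ := le_antisymm (circumradius_le hKρ.subset) (by linarith)
    have hrρ : inradius K = ρ := le_antisymm (by linarith) h3
    have hc1 : c = 1 := by rw [hc, hRρ, hrρ, div_self]; linarith
    have haρ : a = 2 * ρ := by linarith
    refine le_trans (le_of_eq ?_) (le_lintegral_of_closedBall hρ hKρ)
    rw [hc1, haρ]
    congr 1
    ring
  · have h := hK.circumradius_sq_le ha.le
    have : 7 / 3 * Real.pi ^ 3 * a ^ 3
        = 8 * Real.pi ^ 3 * (a * (3 / 8 * a ^ 2) - a ^ 3 / 12) := by ring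
    rw [this]
    gcongr
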